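/- Let $F$ be a field of characteristic zero, and let $E$ be the unital Grassmann algebra over $F$ generated by $1, e_1, e_2, \dots$ subject to $e_ie_j=-e_je_i$. For $k\ge 0$ let $E_k\subseteq E$ be the subalgebra generated by $1,e_1,\dots,e_k$. For a unital associative $F$-algebra $W$, a $W$-algebra is an associative (not necessarily unital) $F$-algebra $A$ which is a unital $W$-bimodule over $F$ such that $w(a_1a_2)=(wa_1)a_2$, $(a_1a_2)w=a_1(a_2w)$ and $(a_1w)a_2=a_1(wa_2)$ for all $w\in W$, $a_1,a_2\in A$. Let $W\langle X\rangle$ be the free $W$-algebra on the countable set $X=\{x_1,x_2,\dots\}$. A $T_W$-ideal is a two-sided ideal of $W\langle X\rangle$ that is stable under left and right multiplication by $W$ and under all $W$-algebra endomorphisms of $W\langle X\rangle$; it is finitely generated if it is the smallest $T_W$-ideal containing some finite set. For a $W$-algebra $A$, let $\mathrm{Id}^W(A)$ be the $T_W$-ideal of all $f\in W\langle X\rangle$ that vanish under every evaluation of the variables in $A$. Take $W=E$. For a unital algebra homomorphism $\varphi:E\to E$ let $E_\varphi$ denote the $E$-algebra $E$ with the action $w\cdot a=\varphi(w)a$, $a\cdot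 w=a\varphi(w)$. Then: 1. for every $k\ge 0$, the $T_E$-ideal $\mathrm{Id}^E(E^{(k)})$ is not finitely generated, where $E^{(k)}=E_\varphi$ for the homomorphism $\varphi$ with $\varphi(e_i)=e_i$ for $i\le k$ and $\varphi(e_i)=0$ for $i>k$; more generally, $\mathrm{Id}^E(E_\varphi)$ is not finitely generated for every $\varphi$ with image $\varphi(E)=E_k$; 2. the $T_E$-ideal $\mathrm{Id}^E(E)$, where $E$ acts on itself by left and right multiplication, is not finitely generated. In particular, not every $T_E$-ideal of $E\langle X\rangle$ is finitely generated, so the Specht property fails for generalized $T_W$-ideals in characteristic zero. -/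

import Mathlib

/-! ### `W`-algebras

`W` is a unital associative algebra over a field `F`, and `A` is an associative `F`-algebra which
is not required to have a unit. -/

/-- A structure of `W`-algebra on the associative (not necessarily unital) `F`-algebra `A`, given by
the left and right representations `λ : W → End_F(A)` and `ρ : W → End_F(A)ᵒᵖ`:
`left w a` is `w a` and `right (op w) a` is `a w`.  Thus `A` is a unital `W`-bimodule and
`(a₁ a₂) w = a₁ (a₂ w)`, `w (a₁ a₂) = (w a₁) a₂`, `(a₁ w) a₂ = a₁ (w a₂)`. -/
structure WAction (F W A : Type*) [Field F] [Ring W] [Algebra F W] [NonUnitalRing A] [Module F A]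
    [IsScalarTower F A A] [SMulCommClass F A A] where
  left : W →ₐ[F] Module.End F A
  right : Wᵐᵒᵖ →ₐ[F] Module.End F A
  bimodule : ∀ (w₁ w₂ : W) (a : A),
    right (MulOpposite.op w₂) (left w₁ a) = left w₁ (right (MulOpposite.op w₂) a)
  right_mul : ∀ (w : W) (a₁ a₂ : A),
    right (MulOpposite.op w) (a₁ * a₂) = a₁ * right (MulOpposite.op w) a₂
  left_mul : ∀ (w : W) (a₁ a₂ : A), left w (a₁ * a₂) = left w a₁ * a₂
  middle : ∀ (w : W) (a₁ a₂ : A), right (MulOpposite.op w) a₁ * a₂ = a₁ * left w a₂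

/-- A homomorphism of `F`-algebras which is a homomorphism of `W`-algebras. -/
structure IsWHom {F W A B : Type*} [Field F] [Ring W] [Algebra F W]
    [NonUnitalRing A] [Module F A] [IsScalarTower F A A] [SMulCommClass F A A]
    [NonUnitalRing B] [Module F B] [IsScalarTower F B B] [SMulCommClass F B B]
    (α : WAction F W A) (β : WAction F W B) (f : A →ₙₐ[F] B) : Prop where
  map_left : ∀ (w : W) (a : A), f (α.left w a) = β.left w (f a)
  map_right : ∀ (w : W) (a : A),
    f (α.right (MulOpposite.op w) a) = β.right (MulOpposite.op w) (f a)

/-- The action of `W` on a unital algebra `A` through a unital homomorphism `φ : W → A`, by left and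
right multiplication: `w a = φ(w) a` and `a w = a φ(w)`. -/
def WAction.ofAlgHom {F W A : Type*} [Field F] [Ring W] [Algebra F W] [Ring A] [Algebra F A]
    (φ : W →ₐ[F] A) : WAction F W A where
  left := (Algebra.lmul F A).comp φ
  right := AlgHom.ofLinearMap
    ((LinearMap.mul F A).flip ∘ₗ φ.toLinearMap ∘ₗ (MulOpposite.opLinearEquiv F).symm.toLinearMap)
    (by ext a; simp)
    (by intro x y; ext a; simp [mul_assoc])
  bimodule := by intro w₁ w₂ a; simp [mul_assoc]
  right_mul := by intro w a₁ a₂; simp [mul_assoc]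
  left_mul := by intro w a₁ a₂; simp [mul_assoc]
  middle := by intro w a₁ a₂; simp [mul_assoc]

theorem WAction.ofAlgHom_left {F W A : Type*} [Field F] [Ring W] [Algebra F W] [Ring A]
    [Algebra F A] (φ : W →ₐ[F] A) (w : W) (a : A) :
    (WAction.ofAlgHom φ).left w a = φ w * a := rfl

theorem WAction.ofAlgHom_right {F W A : Type*} [Field F] [Ring W] [Algebra F W] [Ring A]
    [Algebra F A] (φ : W →ₐ[F] A) (w : W) (a : A) :
    (WAction.ofAlgHom φ).right (MulOpposite.op w) a = a * φ w := rfl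

/-! ### The free `W`-algebra `W⟨X⟩`, `X = {x₀, x₁, …}` -/

namespace FreeWAlgebra

/-- Terms in the operations of a `W`-algebra over the variables `x_i`, `i : ℕ`. -/
inductive Pre (F W : Type*)
  | var : ℕ → Pre F W
  | zero : Pre F W
  | add : Pre F W → Pre F W → Pre F W
  | mul : Pre F W → Pre F W → Pre F W
  | smul : F → Pre F W → Pre F W
  | left : W → Pre F W → Pre F W
  | right : W → Pre F W → Pre F W

open Pre in
/-- The laws of `W`-algebras, closed under congruence. -/
inductive Rel (F W : Type*) [Field F] [Ring W] [Algebra F W] : Pre F W → Pre F W → Prop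
  -- associative `F`-algebra
  | add_assoc (a b c) : Rel F W (add (add a b) c) (add a (add b c))
  | add_comm (a b) : Rel F W (add a b) (add b a)
  | zero_add (a) : Rel F W (add zero a) a
  | mul_assoc (a b c) : Rel F W (mul (mul a b) c) (mul a (mul b c))
  | mul_add (a b c) : Rel F W (mul a (add b c)) (add (mul a b) (mul a c))
  | add_mul (a b c) : Rel F W (mul (add a b) c) (add (mul a c) (mul b c))
  | smul_add (r a b) : Rel F W (smul r (add a b)) (add (smul r a) (smul r b))
  | add_smul (r s a) : Rel F W (smul (r + s) a) (add (smul r a) (smul s a))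
  | mul_smul (r s a) : Rel F W (smul (r * s) a) (smul r (smul s a))
  | one_smul (a) : Rel F W (smul 1 a) a
  | zero_smul (a) : Rel F W (smul 0 a) zero
  | smul_mul (r a b) : Rel F W (mul (smul r a) b) (smul r (mul a b))
  | mul_smul_comm (r a b) : Rel F W (mul a (smul r b)) (smul r (mul a b))
  -- left module over the `F`-algebra `W`
  | left_add (w a b) : Rel F W (left w (add a b)) (add (left w a) (left w b))
  | left_smul (w r a) : Rel F W (left w (smul r a)) (smul r (left w a))
  | add_left (v w a) : Rel F W (left (v + w) a) (add (left v a) (left w a))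
  | smul_left (r w a) : Rel F W (left (r • w) a) (smul r (left w a))
  | one_left (a) : Rel F W (left 1 a) a
  | mul_left (v w a) : Rel F W (left (v * w) a) (left v (left w a))
  -- right module over the `F`-algebra `W`
  | right_add (w a b) : Rel F W (right w (add a b)) (add (right w a) (right w b))
  | right_smul (w r a) : Rel F W (right w (smul r a)) (smul r (right w a))
  | add_right (v w a) : Rel F W (right (v + w) a) (add (right v a) (right w a))
  | smul_right (r w a) : Rel F W (right (r • w) a) (smul r (right w a))
  | one_right (a) : Rel F W (right 1 a) a
  | mul_right (v w a) : Rel F W (right (v * w) a) (right w (right v a))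
  -- compatibility
  | bimodule (v w a) : Rel F W (right w (left v a)) (left v (right w a))
  | right_of_mul (w a b) : Rel F W (right w (mul a b)) (mul a (right w b))
  | left_of_mul (w a b) : Rel F W (left w (mul a b)) (mul (left w a) b)
  | middle (w a b) : Rel F W (mul (right w a) b) (mul a (left w b))
  -- congruence
  | congr_add_left (a a' b) : Rel F W a a' → Rel F W (add a b) (add a' b)
  | congr_add_right (a b b') : Rel F W b b' → Rel F W (add a b) (add a b')
  | congr_mul_left (a a' b) : Rel F W a a' → Rel F W (mul a b) (mul a' b)
  | congr_mul_right (a b b') : Rel F W b b' → Rel F W (mul a b) (mul a b')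
  | congr_smul (r a a') : Rel F W a a' → Rel F W (smul r a) (smul r a')
  | congr_left (w a a') : Rel F W a a' → Rel F W (left w a) (left w a')
  | congr_right (w a a') : Rel F W a a' → Rel F W (right w a) (right w a')

end FreeWAlgebra

/-- The free `W`-algebra on countably many variables: the algebra of generalized polynomials. -/
def FreeWAlgebra (F W : Type*) [Field F] [Ring W] [Algebra F W] : Type _ :=
  Quot (FreeWAlgebra.Rel F W)

namespace FreeWAlgebra

section
variable {F W : Type*} [Field F] [Ring W] [Algebra F W]

instance : Zero (FreeWAlgebra F W) := ⟨Quot.mk _ Pre.zero⟩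

instance : Add (FreeWAlgebra F W) :=
  ⟨Quot.map₂ Pre.add (fun a _ _ h => Rel.congr_add_right a _ _ h)
    (fun _ _ b h => Rel.congr_add_left _ _ b h)⟩

instance : Mul (FreeWAlgebra F W) :=
  ⟨Quot.map₂ Pre.mul (fun a _ _ h => Rel.congr_mul_right a _ _ h)
    (fun _ _ b h => Rel.congr_mul_left _ _ b h)⟩

instance : SMul F (FreeWAlgebra F W) :=
  ⟨fun r => Quot.map (Pre.smul r) (fun _ _ h => Rel.congr_smul r _ _ h)⟩

instance : Neg (FreeWAlgebra F W) := ⟨fun a => (-1 : F) • a⟩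

/-- The variable `x_i`. -/
def x (F W : Type*) [Field F] [Ring W] [Algebra F W] (i : ℕ) : FreeWAlgebra F W :=
  Quot.mk _ (Pre.var i)

/-- Left multiplication by `w`. -/
def leftFun (w : W) : FreeWAlgebra F W → FreeWAlgebra F W :=
  Quot.map (Pre.left w) (fun _ _ h => Rel.congr_left w _ _ h)

/-- Right multiplication by `w`. -/
def rightFun (w : W) : FreeWAlgebra F W → FreeWAlgebra F W :=
  Quot.map (Pre.right w) (fun _ _ h => Rel.congr_right w _ _ h)

theorem zero_smul' (a : FreeWAlgebra F W) : (0 : F) • a = 0 := by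
  induction a using Quot.ind; exact Quot.sound (Rel.zero_smul _)

theorem mul_smul' (r s : F) (a : FreeWAlgebra F W) : (r * s) • a = r • s • a := by
  induction a using Quot.ind; exact Quot.sound (Rel.mul_smul _ _ _)

theorem one_smul' (a : FreeWAlgebra F W) : (1 : F) • a = a := by
  induction a using Quot.ind; exact Quot.sound (Rel.one_smul _)

theorem add_smul' (r s : F) (a : FreeWAlgebra F W) : (r + s) • a = r • a + s • a := by
  induction a using Quot.ind; exact Quot.sound (Rel.add_smul _ _ _)

theorem smul_zero' (r : F) : r • (0 : FreeWAlgebra F W) = 0 := by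
  rw [← zero_smul' (0 : FreeWAlgebra F W), ← mul_smul', mul_zero]

theorem smul_mul' (r : F) (a b : FreeWAlgebra F W) : (r • a) * b = r • (a * b) := by
  induction a using Quot.ind; induction b using Quot.ind; exact Quot.sound (Rel.smul_mul _ _ _)

theorem mul_smul_comm' (r : F) (a b : FreeWAlgebra F W) : a * (r • b) = r • (a * b) := by
  induction a using Quot.ind; induction b using Quot.ind
  exact Quot.sound (Rel.mul_smul_comm _ _ _)

theorem zero_add' (a : FreeWAlgebra F W) : 0 + a = a := by
  induction a using Quot.ind; exact Quot.sound (Rel.zero_add _)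

theorem add_comm' (a b : FreeWAlgebra F W) : a + b = b + a := by
  induction a using Quot.ind; induction b using Quot.ind; exact Quot.sound (Rel.add_comm _ _)

instance : NonUnitalRing (FreeWAlgebra F W) where
  add_assoc a b c := by
    induction a using Quot.ind; induction b using Quot.ind; induction c using Quot.ind
    exact Quot.sound (Rel.add_assoc _ _ _)
  zero_add := zero_add'
  add_zero a := by rw [add_comm', zero_add']
  nsmul := nsmulRec
  zsmul := zsmulRec
  add_comm := add_comm'
  neg_add_cancel a := by
    change (-1 : F) • a + a = 0
    nth_rewrite 2 [← one_smul' a]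
    rw [← add_smul', neg_add_cancel, zero_smul']
  left_distrib a b c := by
    induction a using Quot.ind; induction b using Quot.ind; induction c using Quot.ind
    exact Quot.sound (Rel.mul_add _ _ _)
  right_distrib a b c := by
    induction a using Quot.ind; induction b using Quot.ind; induction c using Quot.ind
    exact Quot.sound (Rel.add_mul _ _ _)
  mul_assoc a b c := by
    induction a using Quot.ind; induction b using Quot.ind; induction c using Quot.ind
    exact Quot.sound (Rel.mul_assoc _ _ _)
  zero_mul a := by rw [← zero_smul' (0 : FreeWAlgebra F W), smul_mul', zero_smul', zero_smul']
  mul_zero a := by rw [← zero_smul' (0 : FreeWAlgebra F W), mul_smul_comm', zero_smul', zero_smul']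

instance : Module F (FreeWAlgebra F W) where
  one_smul := one_smul'
  mul_smul := mul_smul'
  smul_zero := smul_zero'
  smul_add r a b := by
    induction a using Quot.ind; induction b using Quot.ind; exact Quot.sound (Rel.smul_add _ _ _)
  add_smul := add_smul'
  zero_smul := zero_smul'

instance : IsScalarTower F (FreeWAlgebra F W) (FreeWAlgebra F W) := ⟨smul_mul'⟩

instance : SMulCommClass F (FreeWAlgebra F W) (FreeWAlgebra F W) :=
  ⟨fun r a b => (mul_smul_comm' r a b).symm⟩

/-- The `W`-algebra structure of the free `W`-algebra. -/
def action (F W : Type*) [Field F] [Ring W] [Algebra F W] : WAction F W (FreeWAlgebra F W) where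
  left := AlgHom.ofLinearMap
    { toFun := fun w =>
        { toFun := leftFun w
          map_add' := by
            rintro ⟨a⟩ ⟨b⟩; exact Quot.sound (Rel.left_add _ _ _)
          map_smul' := by
            rintro r ⟨a⟩; exact Quot.sound (Rel.left_smul _ _ _) }
      map_add' := by
        intro v w; ext ⟨a⟩; exact Quot.sound (Rel.add_left _ _ _)
      map_smul' := by
        intro r w; ext ⟨a⟩; exact Quot.sound (Rel.smul_left _ _ _) }
    (by ext ⟨a⟩; exact Quot.sound (Rel.one_left _))
    (by intro v w; ext ⟨a⟩; exact Quot.sound (Rel.mul_left _ _ _))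
  right := AlgHom.ofLinearMap
    { toFun := fun w =>
        { toFun := rightFun w.unop
          map_add' := by
            rintro ⟨a⟩ ⟨b⟩; exact Quot.sound (Rel.right_add _ _ _)
          map_smul' := by
            rintro r ⟨a⟩; exact Quot.sound (Rel.right_smul _ _ _) }
      map_add' := by
        intro v w; ext ⟨a⟩; exact Quot.sound (Rel.add_right _ _ _)
      map_smul' := by
        intro r w; ext ⟨a⟩; exact Quot.sound (Rel.smul_right _ _ _) }
    (by ext ⟨a⟩; exact Quot.sound (Rel.one_right _))
    (by intro v w; ext ⟨a⟩; exact Quot.sound (Rel.mul_right _ _ _))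
  bimodule := by rintro v w ⟨a⟩; exact Quot.sound (Rel.bimodule _ _ _)
  right_mul := by rintro w ⟨a⟩ ⟨b⟩; exact Quot.sound (Rel.right_of_mul _ _ _)
  left_mul := by rintro w ⟨a⟩ ⟨b⟩; exact Quot.sound (Rel.left_of_mul _ _ _)
  middle := by rintro w ⟨a⟩ ⟨b⟩; exact Quot.sound (Rel.middle _ _ _)

theorem induction {p : FreeWAlgebra F W → Prop} (var : ∀ i, p (x F W i)) (zero : p 0)
    (add : ∀ a b, p a → p b → p (a + b)) (mul : ∀ a b, p a → p b → p (a * b))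
    (smul : ∀ (r : F) a, p a → p (r • a)) (left : ∀ w a, p a → p ((action F W).left w a))
    (right : ∀ w a, p a → p ((action F W).right (MulOpposite.op w) a)) (a : FreeWAlgebra F W) :
    p a := by
  obtain ⟨t⟩ := a
  induction t with
  | var i => exact var i
  | zero => exact zero
  | add a b ha hb => exact add _ _ ha hb
  | mul a b ha hb => exact mul _ _ ha hb
  | smul r a ha => exact smul r _ ha
  | left w a ha => exact left w _ ha
  | right w a ha => exact right w _ ha

variable {A : Type*} [NonUnitalRing A] [Module F A] [IsScalarTower F A A] [SMulCommClass F A A]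

/-- The value of a term in a `W`-algebra. -/
def Pre.eval (α : WAction F W A) (φ : ℕ → A) : Pre F W → A
  | .var i => φ i
  | .zero => 0
  | .add a b => a.eval α φ + b.eval α φ
  | .mul a b => a.eval α φ * b.eval α φ
  | .smul r a => r • a.eval α φ
  | .left w a => α.left w (a.eval α φ)
  | .right w a => α.right (MulOpposite.op w) (a.eval α φ)

theorem Rel.eval_eq (α : WAction F W A) (φ : ℕ → A) {a b : Pre F W} (h : Rel F W a b) :
    a.eval α φ = b.eval α φ := by
  induction h <;> simp only [Pre.eval]
  case add_assoc => exact _root_.add_assoc _ _ _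
  case add_comm => exact _root_.add_comm _ _
  case zero_add => exact _root_.zero_add _
  case mul_assoc => exact _root_.mul_assoc _ _ _
  case mul_add => exact _root_.mul_add _ _ _
  case add_mul => exact _root_.add_mul _ _ _
  case smul_add => exact _root_.smul_add _ _ _
  case add_smul => exact _root_.add_smul _ _ _
  case mul_smul => exact SemigroupAction.mul_smul _ _ _
  case one_smul => exact _root_.one_smul _ _
  case zero_smul => exact _root_.zero_smul _ _
  case smul_mul => exact smul_mul_assoc _ _ _
  case mul_smul_comm => exact _root_.mul_smul_comm _ _ _
  case bimodule => exact α.bimodule _ _ _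
  case right_of_mul => exact α.right_mul _ _ _
  case left_of_mul => exact α.left_mul _ _ _
  case middle => exact α.middle _ _ _
  all_goals simp_all

/-- The evaluation `W⟨X⟩ → A` at elements `φ 0, φ 1, …` of a `W`-algebra `A`. -/
def eval (α : WAction F W A) (φ : ℕ → A) : FreeWAlgebra F W →ₙₐ[F] A where
  toFun := Quot.lift (Pre.eval α φ) (fun _ _ h => h.eval_eq α φ)
  map_smul' := by rintro r ⟨a⟩; rfl
  map_zero' := rfl
  map_add' := by rintro ⟨a⟩ ⟨b⟩; rfl
  map_mul' := by rintro ⟨a⟩ ⟨b⟩; rfl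

theorem eval_x (α : WAction F W A) (φ : ℕ → A) (i : ℕ) : eval α φ (x F W i) = φ i := rfl

theorem isWHom_eval (α : WAction F W A) (φ : ℕ → A) : IsWHom (action F W) α (eval α φ) where
  map_left := by rintro w ⟨a⟩; rfl
  map_right := by rintro w ⟨a⟩; rfl

/-- With `eval_x` and `isWHom_eval`: the universal property of the free `W`-algebra. -/
theorem eval_unique (α : WAction F W A) (φ : ℕ → A) (f : FreeWAlgebra F W →ₙₐ[F] A)
    (hf : IsWHom (action F W) α f) (hx : ∀ i, f (x F W i) = φ i) : f = eval α φ := by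
  have he := isWHom_eval α φ
  ext a
  induction a using FreeWAlgebra.induction with
  | var i => rw [hx, eval_x]
  | zero => rw [map_zero, map_zero]
  | add a b ha hb => rw [map_add, map_add, ha, hb]
  | mul a b ha hb => rw [map_mul, map_mul, ha, hb]
  | smul r a ha => rw [map_smul, map_smul, ha]
  | left w a ha => rw [hf.map_left, he.map_left, ha]
  | right w a ha => rw [hf.map_right, he.map_right, ha]

end

end FreeWAlgebra

/-! ### `T_W`-ideals and generalized identities -/

section
variable {F W : Type*} [Field F] [Ring W] [Algebra F W]

/-- A `T_W`-ideal of `W⟨X⟩`: a two-sided ideal, stable under the action of `W` on both sides and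
under all endomorphisms of the `W`-algebra `W⟨X⟩`. -/
structure IsTWIdeal (I : Submodule F (FreeWAlgebra F W)) : Prop where
  mul_mem_left : ∀ a, ∀ f ∈ I, a * f ∈ I
  mul_mem_right : ∀ a, ∀ f ∈ I, f * a ∈ I
  left_mem : ∀ w, ∀ f ∈ I, (FreeWAlgebra.action F W).left w f ∈ I
  right_mem : ∀ w, ∀ f ∈ I, (FreeWAlgebra.action F W).right (MulOpposite.op w) f ∈ I
  map_mem : ∀ g : FreeWAlgebra F W →ₙₐ[F] FreeWAlgebra F W,
    IsWHom (FreeWAlgebra.action F W) (FreeWAlgebra.action F W) g → ∀ f ∈ I, g f ∈ I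

/-- The `T_W`-ideal generated by a set of generalized polynomials. -/
def twIdealSpan (S : Set (FreeWAlgebra F W)) : Submodule F (FreeWAlgebra F W) :=
  sInf {I | IsTWIdeal I ∧ S ⊆ I}

theorem isTWIdeal_twIdealSpan (S : Set (FreeWAlgebra F W)) : IsTWIdeal (twIdealSpan S) where
  mul_mem_left a f hf := by
    simp only [twIdealSpan, Submodule.mem_sInf] at hf ⊢
    exact fun I hI => hI.1.mul_mem_left a f (hf I hI)
  mul_mem_right a f hf := by
    simp only [twIdealSpan, Submodule.mem_sInf] at hf ⊢
    exact fun I hI => hI.1.mul_mem_right a f (hf I hI)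
  left_mem a f hf := by
    simp only [twIdealSpan, Submodule.mem_sInf] at hf ⊢
    exact fun I hI => hI.1.left_mem a f (hf I hI)
  right_mem a f hf := by
    simp only [twIdealSpan, Submodule.mem_sInf] at hf ⊢
    exact fun I hI => hI.1.right_mem a f (hf I hI)
  map_mem g hg f hf := by
    simp only [twIdealSpan, Submodule.mem_sInf] at hf ⊢
    exact fun I hI => hI.1.map_mem g hg f (hf I hI)

/-- `I` is generated, as a `T_W`-ideal, by finitely many generalized polynomials. -/
def IsFinGenTWIdeal (I : Submodule F (FreeWAlgebra F W)) : Prop :=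
  ∃ S : Set (FreeWAlgebra F W), S.Finite ∧ twIdealSpan S = I

/-- The Specht property for `W`-algebras over `F`: every `T_W`-ideal is finitely generated. -/
def HasSpechtProperty (F W : Type*) [Field F] [Ring W] [Algebra F W] : Prop :=
  ∀ I : Submodule F (FreeWAlgebra F W), IsTWIdeal I → IsFinGenTWIdeal I

variable {A : Type*} [NonUnitalRing A] [Module F A] [IsScalarTower F A A] [SMulCommClass F A A]

/-- The generalized identities `Id^W(A)` of the `W`-algebra `A`: the generalized polynomials that
vanish under all evaluations in `A`. -/
def genIdentities (α : WAction F W A) : Submodule F (FreeWAlgebra F W) where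
  carrier := {f | ∀ φ : ℕ → A, FreeWAlgebra.eval α φ f = 0}
  add_mem' ha hb φ := by rw [map_add, ha φ, hb φ, add_zero]
  zero_mem' φ := map_zero _
  smul_mem' r a ha φ := by rw [map_smul, ha φ, smul_zero]

theorem isTWIdeal_genIdentities (α : WAction F W A) : IsTWIdeal (genIdentities α) where
  mul_mem_left a f hf φ := by rw [map_mul, hf φ, mul_zero]
  mul_mem_right a f hf φ := by rw [map_mul, hf φ, zero_mul]
  left_mem w f hf φ := by rw [(FreeWAlgebra.isWHom_eval α φ).map_left, hf φ, map_zero]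
  right_mem w f hf φ := by rw [(FreeWAlgebra.isWHom_eval α φ).map_right, hf φ, map_zero]
  map_mem g hg f hf φ := by
    have he := FreeWAlgebra.isWHom_eval α φ
    have h : (FreeWAlgebra.eval α φ).comp g =
        FreeWAlgebra.eval α (fun i => FreeWAlgebra.eval α φ (g (FreeWAlgebra.x F W i))) := by
      apply FreeWAlgebra.eval_unique
      · exact ⟨fun w a => by simp [hg.map_left, he.map_left],
          fun w a => by simp [hg.map_right, he.map_right]⟩
      · intro i; rfl
    exact (congrArg (fun u => u f) h).trans (hf _)

end

/-! ### The Grassmann algebra -/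

/-- The unital Grassmann algebra `E` on generators `e 0, e 1, …`. -/
abbrev GrassmannE (F : Type*) [Field F] : Type _ := ExteriorAlgebra F (ℕ →₀ F)

namespace GrassmannE

/-- The generators of `E`. -/
noncomputable def e (F : Type*) [Field F] (i : ℕ) : GrassmannE F :=
  ExteriorAlgebra.ι F (Finsupp.single i 1)

/-- The finite dimensional Grassmann algebra `E_k`: the subalgebra of `E` generated by `1` and the
first `k` generators. -/
noncomputable def Ek (F : Type*) [Field F] (k : ℕ) : Subalgebra F (GrassmannE F) :=
  Algebra.adjoin F (e F '' {i | i < k})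

/-- The homomorphism `E → E` that fixes the first `k` generators and kills all the others. -/
noncomputable def trunc (F : Type*) [Field F] (k : ℕ) : GrassmannE F →ₐ[F] GrassmannE F :=
  ExteriorAlgebra.map (Finsupp.linearCombination F
    (fun i => if i < k then Finsupp.single i (1 : F) else 0))

theorem trunc_e (F : Type*) [Field F] (k i : ℕ) :
    trunc F k (e F i) = if i < k then e F i else 0 := by
  unfold trunc e
  rw [ExteriorAlgebra.map_apply_ι, Finsupp.linearCombination_single, one_smul]
  split_ifs <;> simp

theorem adjoin_range_e (F : Type*) [Field F] : Algebra.adjoin F (Set.range (e F)) = ⊤ := by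
  rw [eq_top_iff]
  intro a _
  induction a using ExteriorAlgebra.induction with
  | algebraMap r => exact Subalgebra.algebraMap_mem _ r
  | ι v =>
    induction v using Finsupp.induction_linear with
    | zero => simp
    | add v w hv hw => rw [map_add]; exact add_mem (hv trivial) (hw trivial)
    | single i r =>
      have : ExteriorAlgebra.ι F (Finsupp.single i r) = r • e F i := by
        rw [e, ← map_smul, Finsupp.smul_single, smul_eq_mul, mul_one]
      rw [this]
      exact Subalgebra.smul_mem _ (Algebra.subset_adjoin (Set.mem_range_self i)) r
  | mul a b ha hb => exact mul_mem (ha trivial) (hb trivial)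
  | add a b ha hb => exact add_mem (ha trivial) (hb trivial)

/-- `trunc F k` makes `E` act as `E_k`. -/
theorem range_trunc (F : Type*) [Field F] (k : ℕ) : (trunc F k).range = Ek F k := by
  rw [← Algebra.map_top, ← adjoin_range_e, AlgHom.map_adjoin]
  apply le_antisymm
  · apply Algebra.adjoin_le
    rintro _ ⟨_, ⟨i, rfl⟩, rfl⟩
    rw [trunc_e]
    split_ifs with h
    · exact Algebra.subset_adjoin ⟨i, h, rfl⟩
    · exact zero_mem _
  · apply Algebra.adjoin_mono
    rintro _ ⟨i, hi, rfl⟩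
    refine ⟨e F i, ⟨i, rfl⟩, ?_⟩
    exact (trunc_e F k i).trans (if_pos hi)

/-- `E^(k)`: the algebra `E` on which `E` acts as `E_k` by left and right multiplication, where
`e i` acts as itself for the first `k` generators and as zero for the others. -/
noncomputable def actionEk (F : Type*) [Field F] (k : ℕ) :
    WAction F (GrassmannE F) (GrassmannE F) :=
  WAction.ofAlgHom (trunc F k)

/-- The algebra `E` on which `E` acts by left and right multiplication. -/
noncomputable def actionE (F : Type*) [Field F] : WAction F (GrassmannE F) (GrassmannE F) :=
  WAction.ofAlgHom (AlgHom.id F (GrassmannE F))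

end GrassmannE

open Filter

/-! ### A criterion for a `T_W`-ideal not to be finitely generated -/

section
variable {F W B : Type*} [Field F] [Ring W] [Algebra F W]
  [NonUnitalRing B] [Module F B] [IsScalarTower F B B] [SMulCommClass F B B]

/-! A finite set of generalized polynomials involves only finitely many elements of `W`. Suppose
that algebras `A n` embed in `B` and that the action of each single `w` on `A n` agrees, for all
large `n`, with its action on `B`. A finite subset of the identities of `B` then consists of
identities of `A n` for large `n`, and if it generates `genIdentities β`, all identities of `B` hold
in `A n`. So it suffices to find such `A n`, each violating some identity of `B`
(`not_isFinGenTWIdeal_genIdentities`).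

For `φ` with image `E_k`, take `A n = E` and let `perturb` change `φ` at `e n` alone, by adding `u =
prodE F (k + 1)`. Choose `p` with `φ p = φ (e n)` on which both homomorphisms agree. Then `(e n - p)
x` is an identity for `φ`, but its coefficient acts as `u ≠ 0` after the perturbation.

For `E` acting on itself, `e n * x * e n` is an identity. Here `A n` is the ideal generated by `e 0
* e 1`, with the right action twisted by exchanging `e n` and `e (n + 1)`. The value at `e 0 * e 1`
becomes `e n * (e 0 * e 1) * e (n + 1) ≠ 0`. -/

theorem twIdealSpan_le {S : Set (FreeWAlgebra F W)} {I : Submodule F (FreeWAlgebra F W)}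
    (hI : IsTWIdeal I) (hS : S ⊆ I) : twIdealSpan S ≤ I :=
  sInf_le ⟨hI, hS⟩

theorem subset_twIdealSpan (S : Set (FreeWAlgebra F W)) : S ⊆ twIdealSpan S := by
  intro f hf
  simp only [twIdealSpan, SetLike.mem_coe, Submodule.mem_sInf]
  exact fun I hI => hI.2 hf

variable {A : ℕ → Type*} [∀ n, NonUnitalRing (A n)] [∀ n, Module F (A n)]
  [∀ n, IsScalarTower F (A n) (A n)] [∀ n, SMulCommClass F (A n) (A n)]

/-- A generalized polynomial involves finitely many elements of `W`, so maps that are eventually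
compatible with the action of each single element eventually commute with its evaluations. -/
theorem FreeWAlgebra.eventually_map_eval (α : ∀ n, WAction F W (A n)) (β : WAction F W B)
    (g : ∀ n, A n →ₙₐ[F] B)
    (hl : ∀ w, ∀ᶠ n in atTop, ∀ a, g n ((α n).left w a) = β.left w (g n a))
    (hr : ∀ w, ∀ᶠ n in atTop, ∀ a, g n ((α n).right (MulOpposite.op w) a) =
      β.right (MulOpposite.op w) (g n a))
    (f : FreeWAlgebra F W) :
    ∀ᶠ n in atTop, ∀ φ : ℕ → A n,
      g n (FreeWAlgebra.eval (α n) φ f) = FreeWAlgebra.eval β (fun i => g n (φ i)) f := by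
  induction f using FreeWAlgebra.induction with
  | var i => exact Eventually.of_forall fun n φ => by rw [eval_x, eval_x]
  | zero => exact Eventually.of_forall fun n φ => by simp only [map_zero]
  | add a b ha hb => filter_upwards [ha, hb] with n ha hb φ; simp only [map_add, ha, hb]
  | mul a b ha hb => filter_upwards [ha, hb] with n ha hb φ; simp only [map_mul, ha, hb]
  | smul r a ha => filter_upwards [ha] with n ha φ; simp only [map_smul, ha]
  | left w a ha =>
    filter_upwards [ha, hl w] with n ha hw φ
    rw [(isWHom_eval (α n) φ).map_left, (isWHom_eval β _).map_left, hw, ha]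
  | right w a ha =>
    filter_upwards [ha, hr w] with n ha hw φ
    rw [(isWHom_eval (α n) φ).map_right, (isWHom_eval β _).map_right, hw, ha]

/-- The maps `g n` are only algebra homomorphisms: compatibility with `w` is required from some `n`
on that depends on `w`. Finiteness of `S` gives one `n` that serves all the generators, and
injectivity of `g n` pulls their vanishing back to `A n`. -/
theorem not_isFinGenTWIdeal_genIdentities (α : ∀ n, WAction F W (A n)) (β : WAction F W B)
    (g : ∀ n, A n →ₙₐ[F] B) (hg : ∀ n, Function.Injective (g n))
    (hl : ∀ w, ∀ᶠ n in atTop, ∀ a, g n ((α n).left w a) = β.left w (g n a))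
    (hr : ∀ w, ∀ᶠ n in atTop, ∀ a, g n ((α n).right (MulOpposite.op w) a) =
      β.right (MulOpposite.op w) (g n a))
    (h : ∀ᶠ n in atTop, ¬ genIdentities β ≤ genIdentities (α n)) :
    ¬ IsFinGenTWIdeal (genIdentities β) := by
  rintro ⟨S, hS, hSβ⟩
  have hev : ∀ᶠ n in atTop, ∀ f ∈ S, ∀ φ : ℕ → A n,
      g n (FreeWAlgebra.eval (α n) φ f) = FreeWAlgebra.eval β (fun i => g n (φ i)) f :=
    (eventually_all_finite hS).2 fun f _ => FreeWAlgebra.eventually_map_eval α β g hl hr f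
  obtain ⟨n, hn, hle⟩ := (hev.and h).exists
  refine hle (hSβ ▸ twIdealSpan_le (isTWIdeal_genIdentities (α n)) fun f hf φ => hg n ?_)
  have hfβ : f ∈ genIdentities β := hSβ ▸ subset_twIdealSpan S hf
  rw [hn f hf φ, map_zero]
  exact hfβ _

end

namespace GrassmannE

variable {F : Type*} [Field F]

/-! ### Products of generators -/

/-- The alternating form taking the determinant of the coordinates `s 0, …, s (m - 1)` extends to a
linear functional on `E`. Its value at this product is the determinant of the identity matrix. -/
theorem ιMulti_single_ne_zero {m : ℕ} {s : Fin m → ℕ} (hs : Function.Injective s) :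
    ExteriorAlgebra.ιMulti F m (fun i => Finsupp.single (s i) (1 : F)) ≠ 0 := by
  classical
  intro h
  -- `liftAlternating` needs a form in every degree; all but degree `m` are taken to be zero.
  let D : (i : ℕ) → (ℕ →₀ F) [⋀^Fin i]→ₗ[F] F := fun i =>
    if hi : i = m then
      Matrix.detRowAlternating.compLinearMap
        (LinearMap.pi fun j : Fin i => Finsupp.lapply (s (j.cast hi)))
    else 0
  have h1 := congrArg (ExteriorAlgebra.liftAlternating D) h
  rw [ExteriorAlgebra.liftAlternating_apply_ιMulti, map_zero] at h1
  have h2 : (Matrix.of fun i j : Fin m => Finsupp.single (s i) (1 : F) (s j)) = 1 := by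
    ext i j
    simp [Matrix.one_apply, Finsupp.single_apply, hs.eq_iff]
  have h3 : D m (fun i => Finsupp.single (s i) (1 : F)) =
      (Matrix.of fun i j : Fin m => Finsupp.single (s i) (1 : F) (s j)).det := by
    simp only [D, dif_pos]
    rfl
  rw [h3, h2, Matrix.det_one] at h1
  exact one_ne_zero h1

/-- The product of the first `m` generators. -/
noncomputable def prodE (F : Type*) [Field F] (m : ℕ) : GrassmannE F :=
  ExteriorAlgebra.ιMulti F m (fun i => Finsupp.single (i : ℕ) (1 : F))

theorem prodE_ne_zero (m : ℕ) : prodE F m ≠ 0 :=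
  ιMulti_single_ne_zero Fin.val_injective

theorem e_mul_prodE {i m : ℕ} (h : i < m) : e F i * prodE F m = 0 :=
  ExteriorAlgebra.ι_mul_prod_list (fun j : Fin m => Finsupp.single (j : ℕ) (1 : F)) ⟨i, h⟩

theorem prodE_mul_e {i m : ℕ} (h : i < m) : prodE F m * e F i = 0 := by
  have he : e F i = ExteriorAlgebra.ιMulti F 1 (fun _ => Finsupp.single i (1 : F)) := by
    simp [e, ExteriorAlgebra.ιMulti_apply]
  rw [he, prodE, ExteriorAlgebra.ιMulti_mul_ιMulti]
  -- The appended factor repeats the factor in position `i`.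
  refine AlternatingMap.map_eq_zero_of_eq _ _ (i := Fin.castAdd 1 ⟨i, h⟩)
    (j := Fin.natAdd m 0) ?_ ?_
  · rw [Fin.append_left, Fin.append_right]
  · simp [Fin.ext_iff, h.ne]

/-- At least one factor is needed: the empty product is `1`. For this reason `perturb` uses `k + 1`
generators, which covers `k = 0`. -/
theorem prodE_mul_self (m : ℕ) : prodE F (m + 1) * prodE F (m + 1) = 0 := by
  have h : prodE F (m + 1) = e F 0 * ExteriorAlgebra.ιMulti F m
      (Matrix.vecTail fun i : Fin (m + 1) => Finsupp.single (i : ℕ) (1 : F)) :=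
    ExteriorAlgebra.ιMulti_succ_apply _
  nth_rewrite 2 [h]
  rw [← mul_assoc, prodE_mul_e m.succ_pos, zero_mul]

/-- Each generator of `E_k` is a factor of the product and annihilates it on both sides, so only the
scalar part of `a` survives. -/
theorem mul_prodE_of_mem_Ek {k m : ℕ} (hkm : k ≤ m) {a : GrassmannE F} (ha : a ∈ Ek F k) :
    a * prodE F m = ExteriorAlgebra.algebraMapInv a • prodE F m ∧
      prodE F m * a = ExteriorAlgebra.algebraMapInv a • prodE F m := by
  induction ha using Algebra.adjoin_induction with
  | mem _ h =>
    obtain ⟨i, hi, rfl⟩ := h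
    have hi' : i < m := lt_of_lt_of_le hi hkm
    have h0 : ExteriorAlgebra.algebraMapInv (e F i) = 0 := by
      simp [ExteriorAlgebra.algebraMapInv, e]
    rw [e_mul_prodE hi', prodE_mul_e hi', h0, zero_smul]
    exact ⟨rfl, rfl⟩
  | algebraMap r =>
    rw [ExteriorAlgebra.algebraMap_leftInverse]
    exact ⟨(Algebra.smul_def _ _).symm, by rw [← Algebra.commutes, Algebra.smul_def]⟩
  | add a b _ _ ha hb =>
    rw [map_add, add_smul, add_mul, mul_add, ha.1, ha.2, hb.1, hb.2]
    exact ⟨rfl, rfl⟩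
  | mul a b _ _ ha hb =>
    rw [map_mul, mul_assoc, hb.1, mul_smul_comm, ha.1, ← mul_assoc, ha.2, smul_mul_assoc, hb.2,
      smul_smul, smul_smul, mul_comm]
    exact ⟨rfl, rfl⟩

/-- The image of a vector squares to zero, hence so does its scalar part, which lies in a field. -/
theorem algebraMapInv_ι (φ : GrassmannE F →ₐ[F] GrassmannE F) (v : ℕ →₀ F) :
    ExteriorAlgebra.algebraMapInv (φ (ExteriorAlgebra.ι F v)) = 0 := by
  have h := congrArg ExteriorAlgebra.algebraMapInv (ExteriorAlgebra.comp_ι_sq_zero φ v)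
  rwa [map_mul, map_zero, mul_self_eq_zero] at h

/-- Homomorphisms that agree with `φ` at each generator for large `n` do so at each element. -/
theorem eventually_eq_of_generators {φ : GrassmannE F →ₐ[F] GrassmannE F}
    {ψ : ℕ → GrassmannE F →ₐ[F] GrassmannE F}
    (h : ∀ i, ∀ᶠ n in atTop, ψ n (e F i) = φ (e F i)) (w : GrassmannE F) :
    ∀ᶠ n in atTop, ψ n w = φ w := by
  have hw : w ∈ Algebra.adjoin F (Set.range (e F)) := adjoin_range_e F ▸ Algebra.mem_top
  induction hw using Algebra.adjoin_induction with
  | mem _ hx => obtain ⟨i, rfl⟩ := hx; exact h i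
  | algebraMap r => simp
  | add a b _ _ ha hb => filter_upwards [ha, hb] with n ha hb; rw [map_add, map_add, ha, hb]
  | mul a b _ _ ha hb => filter_upwards [ha, hb] with n ha hb; rw [map_mul, map_mul, ha, hb]

/-! ### Actions with image `E_k` -/

/-- The homomorphism that agrees with `φ` at all generators but `e n`, where it differs from `φ` by
the product of the first `k + 1` generators. -/
noncomputable def perturb {k : ℕ} (φ : GrassmannE F →ₐ[F] GrassmannE F)
    (hφ : φ.range = Ek F k) (n : ℕ) : GrassmannE F →ₐ[F] GrassmannE F :=
  ExteriorAlgebra.lift F ⟨φ.toLinearMap ∘ₗ ExteriorAlgebra.ι F +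
      (Finsupp.lapply n).smulRight (prodE F (k + 1)), fun v => by
    -- The image of `v` lies in `E_k` and has no scalar part, so both cross terms of the square
    -- vanish separately, whatever the parity of `k + 1`.
    have hv := mul_prodE_of_mem_Ek k.le_succ (hφ ▸ φ.mem_range_self (ExteriorAlgebra.ι F v))
    rw [algebraMapInv_ι, zero_smul] at hv
    simp only [LinearMap.add_apply, LinearMap.comp_apply, AlgHom.toLinearMap_apply,
      LinearMap.smulRight_apply, mul_add, add_mul, smul_mul_assoc, mul_smul_comm,
      prodE_mul_self, smul_zero]
    erw [hv.1, hv.2]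
    rw [ExteriorAlgebra.comp_ι_sq_zero]
    simp⟩

theorem perturb_e {k : ℕ} (φ : GrassmannE F →ₐ[F] GrassmannE F) (hφ : φ.range = Ek F k)
    (n i : ℕ) : perturb φ hφ n (e F i) = φ (e F i) + if i = n then prodE F (k + 1) else 0 := by
  unfold perturb e
  rw [ExteriorAlgebra.lift_ι_apply]
  simp [Finsupp.single_apply]

theorem eventually_perturb_eq {k : ℕ} (φ : GrassmannE F →ₐ[F] GrassmannE F)
    (hφ : φ.range = Ek F k) (w : GrassmannE F) : ∀ᶠ n in atTop, perturb φ hφ n w = φ w := by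
  refine eventually_eq_of_generators (fun i => ?_) w
  filter_upwards [eventually_gt_atTop i] with n hn
  rw [perturb_e, if_neg hn.ne, add_zero]

/-- One `n` must serve all of `E_k`. It is enough that `perturb φ hφ n` agrees with `φ` at chosen
preimages of the `k` generators, because the equalizer of the two homomorphisms is a subalgebra. -/
theorem eventually_exists_perturb_eq {k : ℕ} (φ : GrassmannE F →ₐ[F] GrassmannE F)
    (hφ : φ.range = Ek F k) :
    ∀ᶠ n in atTop, ∀ a ∈ Ek F k, ∃ p, φ p = a ∧ perturb φ hφ n p = a := by
  have hgen : ∀ i ∈ Set.Iio k, ∃ q, φ q = e F i := fun i hi =>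
    (hφ ▸ Algebra.subset_adjoin ⟨i, hi, rfl⟩ : e F i ∈ φ.range)
  choose! q hq using hgen
  have hev : ∀ᶠ n in atTop, ∀ i ∈ Set.Iio k, perturb φ hφ n (q i) = φ (q i) :=
    (eventually_all_finite (Set.finite_Iio k)).2 fun i _ => eventually_perturb_eq φ hφ (q i)
  filter_upwards [hev] with n hn a ha
  have hle : Ek F k ≤ (AlgHom.equalizer φ (perturb φ hφ n)).map φ :=
    Algebra.adjoin_le (by rintro _ ⟨i, hi, rfl⟩; exact ⟨q i, (hn i hi).symm, hq i hi⟩)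
  obtain ⟨p, hp, rfl⟩ := hle ha
  exact ⟨p, rfl, (hp : φ p = perturb φ hφ n p).symm⟩

theorem not_isFinGenTWIdeal_of_range_eq_Ek {k : ℕ} (φ : GrassmannE F →ₐ[F] GrassmannE F)
    (hφ : φ.range = Ek F k) : ¬ IsFinGenTWIdeal (genIdentities (WAction.ofAlgHom φ)) := by
  refine not_isFinGenTWIdeal_genIdentities (fun n => WAction.ofAlgHom (perturb φ hφ n)) _
    (fun _ => NonUnitalAlgHom.id F (GrassmannE F)) (fun _ => Function.injective_id) (fun w => ?_)
    (fun w => ?_) ?_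
  · filter_upwards [eventually_perturb_eq φ hφ w] with n hn a
    simp [WAction.ofAlgHom_left, hn]
  · filter_upwards [eventually_perturb_eq φ hφ w] with n hn a
    simp [WAction.ofAlgHom_right, hn]
  · filter_upwards [eventually_exists_perturb_eq φ hφ] with n hn hle
    obtain ⟨p, hp, hp'⟩ := hn (φ (e F n)) (hφ ▸ φ.mem_range_self _)
    -- The identity `(e n - p) x`; its coefficient lies in the kernel of `φ`.
    have hmem : (FreeWAlgebra.action F (GrassmannE F)).left (e F n - p)
        (FreeWAlgebra.x F (GrassmannE F) 0) ∈ genIdentities (WAction.ofAlgHom φ) := fun v => by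
      rw [(FreeWAlgebra.isWHom_eval _ v).map_left, WAction.ofAlgHom_left, map_sub, hp, sub_self,
        zero_mul]
    -- At `x = 1` the value is the perturbed image of `e n - p`, which is `prodE F (k + 1)`.
    have h := hle hmem fun _ => 1
    rw [(FreeWAlgebra.isWHom_eval _ _).map_left, WAction.ofAlgHom_left, FreeWAlgebra.eval_x,
      mul_one, map_sub, hp', perturb_e, if_pos rfl, add_sub_cancel_left] at h
    exact prodE_ne_zero _ h

/-! ### The action of `E` on itself -/

theorem ι_mul_ι_eq_neg (v w : ℕ →₀ F) :
    ExteriorAlgebra.ι F v * ExteriorAlgebra.ι F w =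
      -(ExteriorAlgebra.ι F w * ExteriorAlgebra.ι F v) :=
  eq_neg_of_add_eq_zero_left (ExteriorAlgebra.ι_add_mul_swap v w)

/-- Moving a vector past two generators changes the sign twice, so `e i * e j` is central. -/
theorem e_mul_e_mul_comm (i j : ℕ) (w : GrassmannE F) :
    w * (e F i * e F j) = e F i * e F j * w := by
  induction w using ExteriorAlgebra.induction with
  | algebraMap r => exact Algebra.commutes r _
  | ι v =>
    rw [e, e, ← mul_assoc, ι_mul_ι_eq_neg v, neg_mul, mul_assoc, ι_mul_ι_eq_neg v, mul_neg,
      neg_neg, mul_assoc]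
  | mul a b ha hb => rw [mul_assoc, hb, ← mul_assoc, ha, mul_assoc]
  | add a b ha hb => rw [add_mul, mul_add, ha, hb]

theorem e_mul_mul_e (i : ℕ) (w : GrassmannE F) : e F i * w * e F i = 0 := by
  -- Unlike the vanishing of `e i * w * e i`, this property passes to products of `w`, so the
  -- induction goes through.
  have h : ∃ w', e F i * w = w' * e F i := by
    induction w using ExteriorAlgebra.induction with
    | algebraMap r => exact ⟨_, (Algebra.commutes r _).symm⟩
    | ι v => exact ⟨-ExteriorAlgebra.ι F v, by rw [neg_mul, e, ι_mul_ι_eq_neg]⟩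
    | mul a b ha hb =>
      obtain ⟨a', ha⟩ := ha
      obtain ⟨b', hb⟩ := hb
      exact ⟨a' * b', by rw [← mul_assoc, ha, mul_assoc, hb, mul_assoc]⟩
    | add a b ha hb =>
      obtain ⟨a', ha⟩ := ha
      obtain ⟨b', hb⟩ := hb
      exact ⟨a' + b', by rw [mul_add, ha, hb, add_mul]⟩
  obtain ⟨w', hw⟩ := h
  rw [hw, mul_assoc, e, ExteriorAlgebra.ι_sq_zero, mul_zero]

/-- The ideal of `E` generated by `e 0 * e 1`. Its multiplication is zero. -/
noncomputable def nullIdeal (F : Type*) [Field F] : NonUnitalSubalgebra F (GrassmannE F) where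
  toSubmodule := LinearMap.range (LinearMap.mulLeft F (e F 0 * e F 1))
  mul_mem' := by
    rintro _ b ⟨a, rfl⟩ _
    exact ⟨a * b, (mul_assoc _ _ _).symm⟩

theorem mul_mem_nullIdeal (w : GrassmannE F) {a : GrassmannE F} (ha : a ∈ nullIdeal F) :
    w * a ∈ nullIdeal F := by
  obtain ⟨b, rfl⟩ := ha
  exact ⟨w * b, by
    rw [LinearMap.mulLeft_apply, LinearMap.mulLeft_apply, ← mul_assoc, ← e_mul_e_mul_comm,
      mul_assoc]⟩

theorem mem_nullIdeal_mul (w : GrassmannE F) {a : GrassmannE F} (ha : a ∈ nullIdeal F) :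
    a * w ∈ nullIdeal F := by
  obtain ⟨b, rfl⟩ := ha
  exact ⟨b * w, (mul_assoc _ _ _).symm⟩

theorem nullIdeal_mul_eq_zero (a b : nullIdeal F) : a * b = 0 := by
  obtain ⟨_, a, rfl⟩ := a
  obtain ⟨_, b, rfl⟩ := b
  ext
  change (e F 0 * e F 1 * a) * (e F 0 * e F 1 * b) = 0
  have h : e F 0 * e F 1 * (e F 0 * e F 1) = 0 := by
    rw [← mul_assoc, e_mul_mul_e, zero_mul]
  rw [← e_mul_e_mul_comm, mul_assoc, ← mul_assoc _ _ b, h, zero_mul, mul_zero]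

/-- Left multiplication by `w` on the ideal generated by `e 0 * e 1`. -/
noncomputable def nullLeft (w : GrassmannE F) : Module.End F (nullIdeal F) where
  toFun a := ⟨w * a, mul_mem_nullIdeal w a.2⟩
  map_add' _ _ := Subtype.ext (mul_add _ _ _)
  map_smul' _ _ := Subtype.ext (mul_smul_comm _ _ _)

/-- Right multiplication by `w` on the ideal generated by `e 0 * e 1`. -/
noncomputable def nullRight (w : GrassmannE F) : Module.End F (nullIdeal F) where
  toFun a := ⟨a * w, mem_nullIdeal_mul w a.2⟩
  map_add' _ _ := Subtype.ext (add_mul _ _ _)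
  map_smul' _ _ := Subtype.ext (smul_mul_assoc _ _ _)

theorem coe_nullLeft (w : GrassmannE F) (a : nullIdeal F) :
    (nullLeft w a : GrassmannE F) = w * a := rfl

theorem coe_nullRight (w : GrassmannE F) (a : nullIdeal F) :
    (nullRight w a : GrassmannE F) = a * w := rfl

/-- The left representation of `E` on the ideal generated by `e 0 * e 1`. -/
noncomputable def nullLeftHom (F : Type*) [Field F] :
    GrassmannE F →ₐ[F] Module.End F (nullIdeal F) :=
  AlgHom.ofLinearMap
    { toFun := nullLeft
      map_add' := fun _ _ => LinearMap.ext fun _ => Subtype.ext (add_mul _ _ _)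
      map_smul' := fun _ _ => LinearMap.ext fun _ => Subtype.ext (smul_mul_assoc _ _ _) }
    (LinearMap.ext fun _ => Subtype.ext (one_mul _))
    (fun _ _ => LinearMap.ext fun _ => Subtype.ext (mul_assoc _ _ _))

/-- The right representation of `E` on the ideal generated by `e 0 * e 1`, twisted by `τ`. -/
noncomputable def nullRightHom (τ : GrassmannE F →ₐ[F] GrassmannE F) :
    (GrassmannE F)ᵐᵒᵖ →ₐ[F] Module.End F (nullIdeal F) :=
  AlgHom.ofLinearMap
    { toFun := fun w => nullRight (τ w.unop)
      map_add' := fun v w => LinearMap.ext fun a => Subtype.ext <| by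
        rw [MulOpposite.unop_add, map_add]; exact mul_add _ _ _
      map_smul' := fun r w => LinearMap.ext fun a => Subtype.ext <| by
        rw [MulOpposite.unop_smul, map_smul]; exact mul_smul_comm _ _ _ }
    (LinearMap.ext fun a => Subtype.ext <| by
      change (a : GrassmannE F) * τ 1 = a
      rw [map_one, mul_one])
    (fun v w => LinearMap.ext fun a => Subtype.ext <| by
      change (a : GrassmannE F) * τ (w.unop * v.unop) = a * τ w.unop * τ v.unop
      rw [map_mul, mul_assoc])

theorem nullLeftHom_apply (w : GrassmannE F) : nullLeftHom F w = nullLeft w := rfl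

theorem nullRightHom_op (τ : GrassmannE F →ₐ[F] GrassmannE F) (w : GrassmannE F) :
    nullRightHom τ (MulOpposite.op w) = nullRight (τ w) := rfl

/-- The action of `E` on the ideal generated by `e 0 * e 1` by left multiplication, and by right
multiplication twisted by `τ`. -/
noncomputable def twistedAction (τ : GrassmannE F →ₐ[F] GrassmannE F) :
    WAction F (GrassmannE F) (nullIdeal F) where
  left := nullLeftHom F
  right := nullRightHom τ
  bimodule w₁ w₂ a := by
    rw [nullLeftHom_apply, nullRightHom_op]
    refine Subtype.ext ?_
    rw [coe_nullRight, coe_nullLeft, coe_nullLeft, coe_nullRight, mul_assoc]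
  -- The laws that involve products hold because all products in the ideal vanish. On `E` itself,
  -- `middle` at `a₁ = a₂ = 1` would force `τ w = w`.
  right_mul w a₁ a₂ := by
    rw [nullIdeal_mul_eq_zero, nullIdeal_mul_eq_zero, map_zero]
  left_mul w a₁ a₂ := by
    rw [nullIdeal_mul_eq_zero, nullIdeal_mul_eq_zero, map_zero]
  middle w a₁ a₂ := by rw [nullIdeal_mul_eq_zero, nullIdeal_mul_eq_zero]

theorem coe_twistedAction_left (τ : GrassmannE F →ₐ[F] GrassmannE F) (w : GrassmannE F)
    (a : nullIdeal F) : ((twistedAction τ).left w a : GrassmannE F) = w * a := rfl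

theorem coe_twistedAction_right (τ : GrassmannE F →ₐ[F] GrassmannE F) (w : GrassmannE F)
    (a : nullIdeal F) :
    ((twistedAction τ).right (MulOpposite.op w) a : GrassmannE F) = a * τ w := rfl

/-- The automorphism of `E` that exchanges `e n` and `e (n + 1)`. -/
noncomputable def swapE (F : Type*) [Field F] (n : ℕ) : GrassmannE F →ₐ[F] GrassmannE F :=
  ExteriorAlgebra.map (Finsupp.lmapDomain F F (Equiv.swap n (n + 1)))

theorem swapE_e (n i : ℕ) : swapE F n (e F i) = e F (Equiv.swap n (n + 1) i) := by
  simp [swapE, e, ExteriorAlgebra.map_apply_ι, Finsupp.mapDomain_single]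

theorem eventually_swapE_eq (w : GrassmannE F) :
    ∀ᶠ n in atTop, swapE F n w = AlgHom.id F (GrassmannE F) w := by
  refine eventually_eq_of_generators (fun i => ?_) w
  filter_upwards [eventually_gt_atTop i] with n hn
  rw [swapE_e, Equiv.swap_apply_of_ne_of_ne (by omega) (by omega), AlgHom.id_apply]

theorem e_mul_e_mul_e_mul_e_ne_zero {n : ℕ} (hn : 2 ≤ n) :
    e F n * (e F 0 * e F 1) * e F (n + 1) ≠ 0 := by
  -- The bound `2 ≤ n` keeps `n` and `n + 1` apart from `0` and `1`.
  have hs : Function.Injective ![n, 0, 1, n + 1] := by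
    intro i j h
    fin_cases i <;> fin_cases j <;> simp at h ⊢ <;> omega
  have h := ιMulti_single_ne_zero (F := F) hs
  rw [ExteriorAlgebra.ιMulti_apply] at h
  simpa [List.ofFn_succ, e, mul_assoc] using h

theorem not_isFinGenTWIdeal_actionE : ¬ IsFinGenTWIdeal (genIdentities (actionE F)) := by
  refine not_isFinGenTWIdeal_genIdentities (fun n => twistedAction (swapE F n)) _
    (fun _ => NonUnitalSubalgebraClass.subtype (nullIdeal F))
    (fun _ => Subtype.val_injective) (fun w => Eventually.of_forall fun n a => rfl)
    (fun w => ?_) ?_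
  · filter_upwards [eventually_swapE_eq w] with n hn a
    exact congrArg ((a : GrassmannE F) * ·) hn
  · filter_upwards [eventually_ge_atTop 2] with n hn hle
    let A := FreeWAlgebra.action F (GrassmannE F)
    -- The identity `e n * x * e n`, which holds in `E` by `e_mul_mul_e`.
    have hmem : A.right (MulOpposite.op (e F n)) (A.left (e F n)
        (FreeWAlgebra.x F (GrassmannE F) 0)) ∈ genIdentities (actionE F) := fun v => by
      rw [(FreeWAlgebra.isWHom_eval _ v).map_right, (FreeWAlgebra.isWHom_eval _ v).map_left]
      exact e_mul_mul_e n _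
    -- At the generator `e 0 * e 1` of the ideal, the twist turns the right factor `e n` into `e (n
    -- + 1)`.
    have h := hle hmem fun _ => ⟨e F 0 * e F 1, 1, mul_one _⟩
    rw [(FreeWAlgebra.isWHom_eval _ _).map_right, (FreeWAlgebra.isWHom_eval _ _).map_left,
      FreeWAlgebra.eval_x] at h
    have h' := congrArg Subtype.val h
    rw [coe_twistedAction_right, coe_twistedAction_left, swapE_e, Equiv.swap_apply_left] at h'
    exact e_mul_e_mul_e_mul_e_ne_zero hn h'

end GrassmannE

theorem mainTheorem6 (F : Type*) [Field F] [CharZero F] :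
    (∀ k : ℕ, ¬ IsFinGenTWIdeal (genIdentities (GrassmannE.actionEk F k))) ∧
    (∀ (k : ℕ) (φ : GrassmannE F →ₐ[F] GrassmannE F), φ.range = GrassmannE.Ek F k →
      ¬ IsFinGenTWIdeal (genIdentities (WAction.ofAlgHom φ))) ∧
    ¬ IsFinGenTWIdeal (genIdentities (GrassmannE.actionE F)) ∧
    ¬ HasSpechtProperty F (GrassmannE F) :=
  ⟨fun k => GrassmannE.not_isFinGenTWIdeal_of_range_eq_Ek _ (GrassmannE.range_trunc F k),
    fun _ φ hφ => GrassmannE.not_isFinGenTWIdeal_of_range_eq_Ek φ hφ,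
    GrassmannE.not_isFinGenTWIdeal_actionE,
    fun h => GrassmannE.not_isFinGenTWIdeal_actionE (h _ (isTWIdeal_genIdentities _))⟩
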